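/- Let $X$ be a Tychonoff space, let $C(X)$ be the ring of continuous functions $X\to\mathbb R$, $C^*(X)$ the subring of bounded functions, and let $A$ be an intermediate ring, $C^*(X)\subseteq A\subseteq C(X)$. For $f\in C(X)$ let $f^*:\beta X\to\mathbb R\cup\{\infty\}$ be its continuous extension to the Stone–Čech compactification. For an intermediate ring $A$ and $f\in A$ let $\mathcal Z_A(f)$ be the family of zero-sets $E$ of $X$ for which some $g\in A$ satisfies $fg=1$ on $X\setminus E$, and for $p\in\beta X$ let $M_A^p=\{f\in A: p\in \mathrm{cl}_{\beta X}E\text{ for all }E\in\mathcal Z_A(f)\}$, a maximal ideal of $A$. Put $\upsilon_AX=\{p\in\beta X: A/M_A^p\cong\mathbb R\}$ and $A^\nu=\{f\in C(X): f^*(\upsilon_AX)\subseteq\mathbb R\}$, which is again an intermediate ring; let $\theta_p:A^\nu\to K_p:=A^\nu/M_{A^\nu}^p$ be the canonical map. A proper copy of $K_p$ is a proper subfield $\mathfrak F\subsetneq K_p$ that is isomorphic to $K_p$ as a ring; for such $\mathfrak F$ put $B_p^{\mathfrak F}(X)=\theta_p^{-1}(\mathfrak F)$, a subring of $A^\nu$.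 A homeomorphism $h:\beta X\to\beta X$ with $h(p)=q$ is said to induce an isomorphism $\rho:\mathfrak F\to\mathfrak F'$ (where $\mathfrak F\subseteq K_p$ and $\mathfrak F'\subseteq K_q$) if the rule $f\mapsto g$, $g^*=f^*\circ h^{-1}$, is defined on all of $A^\nu$ and maps $A^\nu$ onto itself, and $\rho(\theta_p(f))=\theta_q(g)$ whenever $f,g\in A^\nu$, $g^*=f^*\circ h^{-1}$ and $\theta_p(f)\in\mathfrak F$. **Theorem.** Let $p,q\in\beta X\setminus\upsilon_AX$, let $\mathfrak F$ be a proper copy of $K_p$ and $\mathfrak F'$ a proper copy of $K_q$. Then: 1. The rings $B_p^{\mathfrak F}(X)$ and $B_q^{\mathfrak F'}(X)$ are isomorphic if and only if there is a homeomorphism $h$ of $\beta X$ onto itself with $h(p)=q$ that induces an isomorphism from $\mathfrak F$ onto $\mathfrak F'$. 2. Every ring isomorphism $\varphi:B_p^{\mathfrak F}(X)\to B_q^{\mathfrak F'}(X)$ satisfies $\varphi(M_{A^\nu}^p)=M_{A^\nu}^q$. -/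

import Mathlib

open Topology Filter Set

noncomputable section

namespace IntermediateRings

variable {X : Type*} [TopologicalSpace X]

/-- The Stone extension `f* : βX → ℝ ∪ {∞}` of `f ∈ C(X)`. -/
def stoneExt (f : C(X, ℝ)) : StoneCech X → OnePoint ℝ :=
  stoneCechExtend (g := fun x => ((f x : ℝ) : OnePoint ℝ))
    (OnePoint.continuous_coe.comp f.continuous)

theorem continuous_stoneExt (f : C(X, ℝ)) : Continuous (stoneExt f) :=
  continuous_stoneCechExtend _

theorem stoneExt_unit (f : C(X, ℝ)) (x : X) :
    stoneExt f (stoneCechUnit x) = ((f x : ℝ) : OnePoint ℝ) :=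
  stoneCechExtend_stoneCechUnit _ x

/-- The trace on `X` of the neighbourhood filter of a point of `βX`. -/
def trace (p : StoneCech X) : Filter X := comap stoneCechUnit (𝓝 p)

instance (p : StoneCech X) : (trace p).NeBot :=
  comap_neBot fun _ ht =>
    let ⟨x, hx⟩ := denseRange_stoneCechUnit.mem_nhds ht
    ⟨x, hx⟩

theorem tendsto_stoneExt (f : C(X, ℝ)) (p : StoneCech X) :
    Tendsto (fun x => ((f x : ℝ) : OnePoint ℝ)) (trace p) (𝓝 (stoneExt f p)) := by
  have h : Tendsto (fun x => stoneExt f (stoneCechUnit x)) (trace p) (𝓝 (stoneExt f p)) :=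
    ((continuous_stoneExt f).tendsto p).comp tendsto_comap
  simpa only [stoneExt_unit] using h

theorem stoneExt_eq_coe_iff (f : C(X, ℝ)) (p : StoneCech X) (a : ℝ) :
    stoneExt f p = (a : OnePoint ℝ) ↔ Tendsto f (trace p) (𝓝 a) := by
  constructor
  · intro h
    have h1 := tendsto_stoneExt f p
    rw [h] at h1
    exact OnePoint.isOpenEmbedding_coe.isInducing.tendsto_nhds_iff.2 h1
  · intro h
    exact tendsto_nhds_unique (tendsto_stoneExt f p)
      ((OnePoint.continuous_coe.tendsto a).comp h)

theorem stoneExt_ne_infty_iff (f : C(X, ℝ)) (p : StoneCech X) :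
    stoneExt f p ≠ OnePoint.infty ↔ ∃ a : ℝ, Tendsto f (trace p) (𝓝 a) := by
  rw [OnePoint.ne_infty_iff_exists]
  exact exists_congr fun a => eq_comm.trans (stoneExt_eq_coe_iff f p a)

theorem stoneExt_ne_infty_of_bounded (f : C(X, ℝ)) (hf : ∃ C : ℝ, ∀ x, |f x| ≤ C)
    (p : StoneCech X) : stoneExt f p ≠ OnePoint.infty := by
  obtain ⟨C, hC⟩ := hf
  have hcl : IsClosed (((↑) : ℝ → OnePoint ℝ) '' Icc (-C) C) :=
    (isCompact_Icc.image OnePoint.continuous_coe).isClosed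
  have hmem : stoneExt f p ∈ ((↑) : ℝ → OnePoint ℝ) '' Icc (-C) C :=
    hcl.mem_of_tendsto (tendsto_stoneExt f p)
      (Eventually.of_forall fun x => ⟨f x, abs_le.1 (hC x), rfl⟩)
  obtain ⟨a, -, ha⟩ := hmem
  rw [← ha]
  exact OnePoint.coe_ne_infty a

variable (X) in
/-- Intermediate rings `C*(X) ⊆ A(X) ⊆ C(X)`. They contain the constants, so they are
exactly the subalgebras of `C(X)` that contain `C*(X)`. -/
structure IntermediateRing extends Subring C(X, ℝ) where
  bounded_mem : ∀ f : C(X, ℝ), (∃ C : ℝ, ∀ x, |f x| ≤ C) → f ∈ carrier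

/-- `E` is a zero-set of `X`. -/
def IsZeroSet (E : Set X) : Prop := ∃ k : C(X, ℝ), E = {x | k x = 0}

/-- `f` is `E`-regular in the ring `A`: it has an inverse on `E` that comes from `A`. -/
def IsRegularOn (A : IntermediateRing X) (f : C(X, ℝ)) (E : Set X) : Prop :=
  ∃ g ∈ A.toSubring, ∀ x ∈ E, f x * g x = 1

/-- `𝒵_A(f)`: the zero-sets of `X` on whose complement `f` is regular. -/
def zeroFamily (A : IntermediateRing X) (f : C(X, ℝ)) : Set (Set X) :=
  {E | IsZeroSet E ∧ IsRegularOn A f Eᶜ}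

/-- `S[ℱ]`: the intersection of the closures in `βX` of the members of `ℱ`. -/
def clusterSet (F : Set (Set X)) : Set (StoneCech X) :=
  {p | ∀ E ∈ F, p ∈ closure (stoneCechUnit '' E)}

theorem mem_clusterSet_iff (A : IntermediateRing X) (f : C(X, ℝ)) (p : StoneCech X) :
    p ∈ clusterSet (zeroFamily A f) ↔
      ∀ g ∈ A.toSubring, Tendsto (f * g) (trace p) (𝓝 0) := by
  constructor
  · intro hp g hg
    rw [Metric.tendsto_nhds]
    by_contra hcon
    rw [not_forall₂] at hcon
    obtain ⟨ε, hε, hfreq⟩ := hcon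
    -- the value of the extension of `f * g` at `p` is not `0`
    have hne : stoneExt (f * g) p ≠ ((0 : ℝ) : OnePoint ℝ) := by
      intro h0
      rw [stoneExt_eq_coe_iff, Metric.tendsto_nhds] at h0
      exact hfreq (h0 ε hε)
    obtain ⟨U, V, hU, hV, hpU, hV0, hUV⟩ := t2_separation hne
    have hV' : ((↑) : ℝ → OnePoint ℝ) ⁻¹' V ∈ 𝓝 (0 : ℝ) :=
      (hV.preimage OnePoint.continuous_coe).mem_nhds hV0
    obtain ⟨δ, hδ, hball⟩ := Metric.mem_nhds_iff.1 hV'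
    let u : C(X, ℝ) := f * g
    let d : ℝ := δ / 2
    have hd : 0 < d := half_pos hδ
    have hmax : ∀ x, 0 < max (u x ^ 2) (d ^ 2) := fun x => lt_max_of_lt_right (by positivity)
    let k : C(X, ℝ) := ⟨fun x => u x / max (u x ^ 2) (d ^ 2), by
      have := u.continuous
      exact this.div (by fun_prop) (fun x => (hmax x).ne')⟩
    have hk : k ∈ A.toSubring := by
      refine A.bounded_mem k ⟨1 / d, fun x => ?_⟩
      change |u x / max (u x ^ 2) (d ^ 2)| ≤ 1 / d
      rw [abs_div, abs_of_pos (hmax x), div_le_div_iff₀ (hmax x) hd, one_mul]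
      rcases le_total |u x| d with h | h
      · exact le_trans (by nlinarith [abs_nonneg (u x)]) (le_max_right _ _)
      · exact le_trans (by nlinarith [abs_nonneg (u x), sq_abs (u x)]) (le_max_left _ _)
    let E : Set X := {x | |u x| ≤ d}
    have hE : E ∈ zeroFamily A f := by
      refine ⟨⟨⟨fun x => max (|u x| - d) 0, by fun_prop⟩, ?_⟩, g * k, mul_mem hg hk, ?_⟩
      · ext x
        simp [E]
      · intro x hx
        have hx' : d < |u x| := not_le.1 hx
        have hu : u x ≠ 0 := by
          intro h
          rw [h, abs_zero] at hx'
          linarith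
        have hsq : d ^ 2 ≤ u x ^ 2 := by
          rw [← sq_abs (u x)]
          gcongr
        change f x * (g x * (u x / max (u x ^ 2) (d ^ 2))) = 1
        rw [max_eq_left hsq, ← mul_assoc]
        change u x * (u x / u x ^ 2) = 1
        field_simp
    have hpE := hp E hE
    rw [mem_closure_iff] at hpE
    obtain ⟨_, hyU, x, hx, rfl⟩ :=
      hpE (stoneExt (f * g) ⁻¹' U) (hU.preimage (continuous_stoneExt _)) hpU
    rw [mem_preimage, stoneExt_unit] at hyU
    have hxV : (((f * g) x : ℝ) : OnePoint ℝ) ∈ V := by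
      apply hball
      rw [Metric.mem_ball, Real.dist_eq, sub_zero]
      exact lt_of_le_of_lt hx (half_lt_self hδ)
    exact Set.disjoint_left.1 hUV hyU hxV
  · rintro h E ⟨-, g, hg, hE⟩
    by_contra hpE
    have hU : (closure (stoneCechUnit '' E))ᶜ ∈ 𝓝 p :=
      isClosed_closure.isOpen_compl.mem_nhds hpE
    have h1 : ∀ᶠ x in trace p, x ∉ E := by
      filter_upwards [preimage_mem_comap hU] with x hx hxE
      exact hx (subset_closure ⟨x, hxE, rfl⟩)
    have h2 : Tendsto (f * g) (trace p) (𝓝 1) :=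
      (tendsto_const_nhds (x := (1 : ℝ))).congr' (by
        filter_upwards [h1] with x hx
        exact (hE x hx).symm)
    exact zero_ne_one (tendsto_nhds_unique (h g hg) h2)

/-- The maximal ideal `M_A^p = {f ∈ A(X) : p ∈ S[𝒵_A(f)]}`. -/
def maxIdeal (A : IntermediateRing X) (p : StoneCech X) : Ideal A.toSubring where
  carrier := {f | p ∈ clusterSet (zeroFamily A (f : C(X, ℝ)))}
  zero_mem' := by
    rw [mem_ofPred_eq, mem_clusterSet_iff]
    intro g _
    refine (tendsto_const_nhds (x := (0 : ℝ))).congr fun x => ?_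
    simp
  add_mem' := by
    intro a b ha hb
    rw [mem_ofPred_eq, mem_clusterSet_iff] at *
    intro g hg
    have := (ha g hg).add (hb g hg)
    rw [add_zero] at this
    refine this.congr fun x => ?_
    simp [add_mul]
  smul_mem' := by
    intro c a ha
    rw [mem_ofPred_eq, mem_clusterSet_iff] at *
    intro g hg
    refine (ha (c * g) (mul_mem c.2 hg)).congr fun x => ?_
    simp only [ContinuousMap.coe_mul, Pi.mul_apply, smul_eq_mul, Subring.coe_mul]
    ring

/-- `υ_A X`: the points `p` of `βX` for which `A(X) / M_A^p` is isomorphic to `ℝ`. -/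
def realPoints (A : IntermediateRing X) : Set (StoneCech X) :=
  {p | Nonempty ((A.toSubring ⧸ maxIdeal A p) ≃+* ℝ)}

/-- `A^ν(X) = {f ∈ C(X) : f*(υ_A X) ⊆ ℝ}`. -/
def nu (A : IntermediateRing X) : IntermediateRing X where
  carrier := {f | ∀ p ∈ realPoints A, stoneExt f p ≠ OnePoint.infty}
  bounded_mem f hf p _ := stoneExt_ne_infty_of_bounded f hf p
  zero_mem' p _ := stoneExt_ne_infty_of_bounded 0 ⟨0, by simp⟩ p
  one_mem' p _ := stoneExt_ne_infty_of_bounded 1 ⟨1, by simp⟩ p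
  add_mem' := by
    intro f g hf hg p hp
    obtain ⟨a, ha⟩ := (stoneExt_ne_infty_iff f p).1 (hf p hp)
    obtain ⟨b, hb⟩ := (stoneExt_ne_infty_iff g p).1 (hg p hp)
    exact (stoneExt_ne_infty_iff _ p).2 ⟨a + b, ha.add hb⟩
  mul_mem' := by
    intro f g hf hg p hp
    obtain ⟨a, ha⟩ := (stoneExt_ne_infty_iff f p).1 (hf p hp)
    obtain ⟨b, hb⟩ := (stoneExt_ne_infty_iff g p).1 (hg p hp)
    exact (stoneExt_ne_infty_iff _ p).2 ⟨a * b, ha.mul hb⟩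
  neg_mem' := by
    intro f hf p hp
    obtain ⟨a, ha⟩ := (stoneExt_ne_infty_iff f p).1 (hf p hp)
    exact (stoneExt_ne_infty_iff _ p).2 ⟨-a, ha.neg⟩

/-- The ideal `M_{A^ν}^p` of `A^ν(X)`. -/
abbrev nuIdeal (A : IntermediateRing X) (p : StoneCech X) : Ideal (nu A).toSubring :=
  maxIdeal (nu A) p

/-- The residue field `A^ν(X) / M_{A^ν}^p`. -/
abbrev ResidueField (A : IntermediateRing X) (p : StoneCech X) : Type _ :=
  (nu A).toSubring ⧸ nuIdeal A p

/-- The canonical map `θ_p : A^ν(X) → A^ν(X) / M_{A^ν}^p`. -/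
abbrev theta (A : IntermediateRing X) (p : StoneCech X) :
    (nu A).toSubring →+* ResidueField A p :=
  Ideal.Quotient.mk (nuIdeal A p)

/-- `F` is a proper copy of the ring `K` inside `K` (a subfield, when `K` is a field). -/
def IsProperCopy {K : Type*} [CommRing K] (F : Subring K) : Prop :=
  F ≠ ⊤ ∧ Nonempty (K ≃+* F)

/-- The ring `B_p^F(X) = θ_p⁻¹(F)`. -/
def ringB (A : IntermediateRing X) (p : StoneCech X) (F : Subring (ResidueField A p)) :
    Subring (nu A).toSubring :=
  F.comap (theta A p)

/-- `g* ∘ h = f*`, that is, `g` is the function that `f` is carried to by the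
homeomorphism `h` of `βX`. -/
def Transports (h : StoneCech X ≃ₜ StoneCech X) (f g : C(X, ℝ)) : Prop :=
  ∀ r : StoneCech X, stoneExt g (h r) = stoneExt f r

/-- The homeomorphism `h` of `βX` induces the isomorphism `ρ : F → F'`: the rule
`f* ↦ f* ∘ h⁻¹` carries `A^ν(X)` onto itself, and `ρ` is the map that this rule gives on
residue classes. -/
def Induces (A : IntermediateRing X) {p q : StoneCech X} (h : StoneCech X ≃ₜ StoneCech X)
    {F : Subring (ResidueField A p)} {F' : Subring (ResidueField A q)}
    (ρ : F ≃+* F') : Prop :=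
  (∀ f : (nu A).toSubring, ∃ g : (nu A).toSubring, Transports h (f : C(X, ℝ)) g) ∧
  (∀ g : (nu A).toSubring, ∃ f : (nu A).toSubring, Transports h (f : C(X, ℝ)) g) ∧
  ∀ f g : (nu A).toSubring, Transports h (f : C(X, ℝ)) g →
    ∀ hf : theta A p f ∈ F, (ρ ⟨theta A p f, hf⟩ : ResidueField A q) = theta A q g

end IntermediateRings

end

open Topology Filter Set

noncomputable section

namespace IntermediateRings

variable {X : Type*} [TopologicalSpace X]

/-! ### Stone extensions and transport -/

/-! The ring `B_p^F` remembers `βX`. It contains `M_{A^ν}^p`, hence every bump function vanishing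
near `p`, so it separates the points of `βX`. In `K_p` every element is a square up to sign, and `F`
inherits this as a copy; therefore `B_p^F` is closed under square roots of nonnegative functions,
and likewise under `f ↦ 1 / (1 + f²)`. Nonnegativity thus means being a square, any ring isomorphism
`φ` preserves order, and compactness turns `φ` into transport along a homeomorphism `h` of `βX`
(`IsSeparatingRootClosed.exists_homeomorph`).

The non-real points are those where some member of `B_p^F` is infinite
(`exists_ringB_stoneExt_eq_infty`); at `p` itself this holds because `F` is as nonarchimedean as
`K_p`. So `h` preserves `υ_A X` and transports `A^ν` onto itself. If `h p ≠ q`, then `B_q^{F'}` is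
unconstrained near `h p`, so `B_p^F` would represent every class of `K_p`, contradicting `F ≠ ⊤`.
Hence `h p = q`, the ideals at `p` and `q` correspond, and passing to quotients gives `ρ : F ≃ F'`.

Conversely, an inducing `h` transports `B_p^F` onto `B_q^{F'}`, because membership depends only on
the residue class. -/

theorem tendsto_abs_atTop_of_stoneExt_eq_infty {f : C(X, ℝ)} {r : StoneCech X}
    (h : stoneExt f r = OnePoint.infty) : Tendsto (fun x => |f x|) (trace r) atTop := by
  refine tendsto_atTop.2 fun C => ?_
  have hcl : IsClosed (((↑) : ℝ → OnePoint ℝ) '' Icc (-C) C) :=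
    (isCompact_Icc.image OnePoint.continuous_coe).isClosed
  have hmem : (((↑) : ℝ → OnePoint ℝ) '' Icc (-C) C)ᶜ ∈ 𝓝 (stoneExt f r) := by
    refine hcl.isOpen_compl.mem_nhds ?_
    rw [h]
    exact OnePoint.infty_notMem_image_coe
  filter_upwards [tendsto_stoneExt f r hmem] with x hx
  by_contra hC
  exact hx ⟨f x, abs_le.1 (not_le.1 hC).le, rfl⟩

theorem stoneExt_eq_infty_iff {f : C(X, ℝ)} {r : StoneCech X} :
    stoneExt f r = OnePoint.infty ↔ Tendsto (fun x => |f x|) (trace r) atTop := by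
  refine ⟨tendsto_abs_atTop_of_stoneExt_eq_infty, fun h => ?_⟩
  by_contra hne
  obtain ⟨a, ha⟩ := (stoneExt_ne_infty_iff f r).1 hne
  exact not_tendsto_nhds_of_tendsto_atTop h _ ha.abs

theorem stoneExt_congr {f g : C(X, ℝ)} {r : StoneCech X} (h : f =ᶠ[trace r] g) :
    stoneExt f r = stoneExt g r := by
  refine tendsto_nhds_unique (tendsto_stoneExt f r) ((tendsto_stoneExt g r).congr' ?_)
  filter_upwards [h] with x hx
  rw [hx]

variable {h : StoneCech X ≃ₜ StoneCech X} {f f' g g' : C(X, ℝ)}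

/-- By density of `X` in `βX` the condition need only be tested on `X`, where `g` is finite; this
reduces algebraic identities to limits in `ℝ`. -/
theorem transports_iff :
    Transports h f g ↔ ∀ x, stoneExt f (h.symm (stoneCechUnit x)) = ((g x : ℝ) : OnePoint ℝ) := by
  constructor
  · intro hT x
    rw [← hT, h.apply_symm_apply, stoneExt_unit]
  · intro hT r
    have hfun : stoneExt g = stoneExt f ∘ h.symm := by
      refine denseRange_stoneCechUnit.equalizer (continuous_stoneExt g)
        ((continuous_stoneExt f).comp h.symm.continuous) ?_
      funext x
      simp only [Function.comp_apply, stoneExt_unit, hT]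
    rw [hfun, Function.comp_apply, h.symm_apply_apply]

theorem Transports.tendsto (hT : Transports h f g) (x : X) :
    Tendsto f (trace (h.symm (stoneCechUnit x))) (𝓝 (g x)) :=
  (stoneExt_eq_coe_iff _ _ _).1 (transports_iff.1 hT x)

theorem Transports.add (hT : Transports h f g) (hT' : Transports h f' g') :
    Transports h (f + f') (g + g') :=
  transports_iff.2 fun x => (stoneExt_eq_coe_iff _ _ _).2 ((hT.tendsto x).add (hT'.tendsto x))

theorem Transports.mul (hT : Transports h f g) (hT' : Transports h f' g') :
    Transports h (f * f') (g * g') :=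
  transports_iff.2 fun x => (stoneExt_eq_coe_iff _ _ _).2 ((hT.tendsto x).mul (hT'.tendsto x))

theorem Transports.sub (hT : Transports h f g) (hT' : Transports h f' g') :
    Transports h (f - f') (g - g') :=
  transports_iff.2 fun x => (stoneExt_eq_coe_iff _ _ _).2 ((hT.tendsto x).sub (hT'.tendsto x))

theorem Transports.symm (hT : Transports h f g) : Transports h.symm g f := fun r => by
  rw [← hT, h.apply_symm_apply]

theorem Transports.right_unique (hT : Transports h f g) (hT' : Transports h f g') : g = g' := by
  ext x
  exact OnePoint.coe_injective ((transports_iff.1 hT x).symm.trans (transports_iff.1 hT' x))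

theorem Transports.left_unique (hT : Transports h f g) (hT' : Transports h f' g) : f = f' :=
  hT.symm.right_unique hT'.symm

theorem exists_transports (hf : ∀ x, stoneExt f (h.symm (stoneCechUnit x)) ≠ OnePoint.infty) :
    ∃ g, Transports h f g := by
  choose g hg using fun x => OnePoint.ne_infty_iff_exists.1 (hf x)
  refine ⟨⟨g, ?_⟩, transports_iff.2 fun x => (hg x).symm⟩
  refine OnePoint.isOpenEmbedding_coe.isInducing.continuous_iff.2 ?_
  have : ((↑) : ℝ → OnePoint ℝ) ∘ g = fun x => stoneExt f (h.symm (stoneCechUnit x)) := funext hg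
  rw [this]
  exact (continuous_stoneExt f).comp (h.symm.continuous.comp continuous_stoneCechUnit)

theorem Transports.tendsto_iff (hT : Transports h f g) {p q : StoneCech X} (hpq : h p = q)
    {a : ℝ} : Tendsto f (trace p) (𝓝 a) ↔ Tendsto g (trace q) (𝓝 a) := by
  rw [← stoneExt_eq_coe_iff, ← stoneExt_eq_coe_iff, ← hpq, hT]

theorem exists_bump {r : StoneCech X} {C : Set (StoneCech X)} (hC : IsClosed C) (hr : r ∉ C) :
    ∃ k : C(X, ℝ), (∀ x, |k x| ≤ 1) ∧ (∀ᶠ x in trace r, k x = 1) ∧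
      ∀ c ∈ C, ∀ᶠ x in trace c, k x = 0 := by
  obtain ⟨u, hu0, hu1, -⟩ := exists_continuous_zero_one_of_isClosed hC
    (isClosed_singleton (x := r)) (disjoint_singleton_right.2 hr)
  have hu1' : u r = 1 := hu1 rfl
  -- Clipping `3u - 1` to `[0, 1]` makes the Urysohn function `u` constant near the prescribed
  -- points: it is `1` where `u > 2/3` and `0` where `u < 1/3`.
  refine ⟨⟨fun x => max 0 (min 1 (3 * u (stoneCechUnit x) - 1)), ?_⟩, fun x => ?_, ?_,
    fun c hc => ?_⟩
  · have := continuous_stoneCechUnit (α := X)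
    fun_prop
  · change |max 0 (min 1 (3 * u (stoneCechUnit x) - 1))| ≤ 1
    rw [abs_of_nonneg (le_max_left _ _)]
    exact max_le zero_le_one (min_le_left _ _)
  · have h1 : ∀ᶠ s in 𝓝 r, 2 / 3 < u s :=
      (u.continuous.tendsto r).eventually (lt_mem_nhds (by rw [hu1']; norm_num))
    filter_upwards [preimage_mem_comap h1] with x hx
    have hx' : 2 / 3 < u (stoneCechUnit x) := hx
    change max 0 (min 1 (3 * u (stoneCechUnit x) - 1)) = 1
    rw [min_eq_left (by linarith), max_eq_right zero_le_one]
  · have hc0 : u c = 0 := hu0 hc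
    have h1 : ∀ᶠ s in 𝓝 c, u s < 1 / 3 :=
      (u.continuous.tendsto c).eventually (gt_mem_nhds (by rw [hc0]; norm_num))
    filter_upwards [preimage_mem_comap h1] with x hx
    have hx' : u (stoneCechUnit x) < 1 / 3 := hx
    change max 0 (min 1 (3 * u (stoneCechUnit x) - 1)) = 0
    exact max_eq_left ((min_le_right _ _).trans (by linarith))

/-! ### The ideals `M_A^p` and the real points -/

theorem mem_maxIdeal_iff {A : IntermediateRing X} {p : StoneCech X} {f : A.toSubring} :
    f ∈ maxIdeal A p ↔ ∀ g ∈ A.toSubring, Tendsto ((f : C(X, ℝ)) * g) (trace p) (𝓝 0) :=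
  mem_clusterSet_iff A f p

theorem tendsto_of_mem_maxIdeal {A : IntermediateRing X} {p : StoneCech X} {f : A.toSubring}
    (hf : f ∈ maxIdeal A p) : Tendsto (f : C(X, ℝ)) (trace p) (𝓝 0) := by
  simpa using mem_maxIdeal_iff.1 hf 1 A.toSubring.one_mem

theorem mem_maxIdeal_of_eventually_eq_zero {A : IntermediateRing X} {p : StoneCech X}
    {f : A.toSubring} (hf : ∀ᶠ x in trace p, (f : C(X, ℝ)) x = 0) : f ∈ maxIdeal A p := by
  refine mem_maxIdeal_iff.2 fun g _ => tendsto_const_nhds.congr' ?_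
  filter_upwards [hf] with x hx
  simp [hx]

/-- Outside the ideal, `f` has an inverse from `A` off a zero-set whose closure misses `p`, hence on
the trace of a neighbourhood of `p`. -/
theorem exists_mul_sub_one_mem_maxIdeal {A : IntermediateRing X} {p : StoneCech X}
    {f : A.toSubring} (hf : f ∉ maxIdeal A p) : ∃ g : A.toSubring, f * g - 1 ∈ maxIdeal A p := by
  have hf' : ¬ ∀ E ∈ zeroFamily A (f : C(X, ℝ)), p ∈ closure (stoneCechUnit '' E) := hf
  push Not at hf'
  obtain ⟨E, ⟨-, g, hg, hE⟩, hpE⟩ := hf'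
  refine ⟨⟨g, hg⟩, mem_maxIdeal_of_eventually_eq_zero ?_⟩
  have hU : (closure (stoneCechUnit '' E))ᶜ ∈ 𝓝 p := isClosed_closure.isOpen_compl.mem_nhds hpE
  filter_upwards [preimage_mem_comap hU] with x hx
  have h1 := hE x fun hxE => hx (subset_closure ⟨x, hxE, rfl⟩)
  simp [h1]

/-- The constant functions, as a map into an intermediate ring. -/
def constHom (A : IntermediateRing X) : ℝ →+* A.toSubring :=
  (ContinuousMap.C : ℝ →+* C(X, ℝ)).codRestrict A.toSubring fun c =>
    A.bounded_mem _ ⟨|c|, fun _ => le_rfl⟩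

theorem constHom_apply (A : IntermediateRing X) (c : ℝ) (x : X) :
    (constHom A c : C(X, ℝ)) x = c := rfl

/-- The only ring endomorphism of `ℝ` is the identity, so an isomorphism of the quotient with `ℝ`
fixes constants and its value at `f` is the limit of `f` at `p`. Conversely, if all limits are
finite, taking them is a surjection onto `ℝ` with kernel `M_A^p`. -/
theorem mem_realPoints_iff {A : IntermediateRing X} {p : StoneCech X} :
    p ∈ realPoints A ↔ ∀ f ∈ A.toSubring, stoneExt f p ≠ OnePoint.infty := by
  constructor
  · rintro ⟨e⟩ f hf hinf
    let ψ : A.toSubring →+* ℝ := (e : _ →+* ℝ).comp (Ideal.Quotient.mk (maxIdeal A p))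
    have hψ : ∀ c, ψ (constHom A c) = c := fun c =>
      DFunLike.congr_fun (Subsingleton.elim (ψ.comp (constHom A)) (RingHom.id ℝ)) c
    let F : A.toSubring := ⟨f, hf⟩
    have hmem : F - constHom A (ψ F) ∈ maxIdeal A p := by
      rw [← Ideal.Quotient.eq_zero_iff_mem]
      apply e.injective
      have : ψ (F - constHom A (ψ F)) = 0 := by rw [map_sub, hψ, sub_self]
      rw [map_zero]
      exact this
    have h1 := (tendsto_of_mem_maxIdeal hmem).add_const (ψ F)
    have h2 : Tendsto f (trace p) (𝓝 (0 + ψ F)) := h1.congr fun x => by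
      simp [F, constHom_apply]
    exact (stoneExt_ne_infty_iff f p).2 ⟨_, h2⟩ hinf
  · intro hfin
    have hex : ∀ f : A.toSubring, ∃ a : ℝ, Tendsto (f : C(X, ℝ)) (trace p) (𝓝 a) := fun f =>
      (stoneExt_ne_infty_iff _ p).1 (hfin f f.2)
    choose L hL using hex
    let ψ : A.toSubring →+* ℝ :=
      { toFun := L
        map_one' := tendsto_nhds_unique (hL 1) tendsto_const_nhds
        map_zero' := tendsto_nhds_unique (hL 0) tendsto_const_nhds
        map_mul' := fun f g => tendsto_nhds_unique (hL (f * g)) ((hL f).mul (hL g))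
        map_add' := fun f g => tendsto_nhds_unique (hL (f + g)) ((hL f).add (hL g)) }
    have hsurj : Function.Surjective ψ := fun c =>
      ⟨constHom A c, tendsto_nhds_unique (hL (constHom A c)) tendsto_const_nhds⟩
    have hker : RingHom.ker ψ = maxIdeal A p := by
      ext f
      rw [RingHom.mem_ker]
      constructor
      · intro hf
        refine mem_maxIdeal_iff.2 fun g hg => ?_
        have hf0 : L f = 0 := hf
        have := (hL f).mul (hL ⟨g, hg⟩)
        rwa [hf0, zero_mul] at this
      · intro hf
        exact tendsto_nhds_unique (hL f) (tendsto_of_mem_maxIdeal hf)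
    exact ⟨(Ideal.quotEquivOfEq hker.symm).trans (RingHom.quotientKerEquivOfSurjective hsurj)⟩

theorem le_nu (A : IntermediateRing X) : A.toSubring ≤ (nu A).toSubring := fun f hf _ hr =>
  mem_realPoints_iff.1 hr f hf

theorem unit_mem_realPoints (A : IntermediateRing X) (x : X) :
    stoneCechUnit x ∈ realPoints A :=
  mem_realPoints_iff.2 fun f _ => by
    rw [stoneExt_unit]
    exact OnePoint.coe_ne_infty _

theorem exists_nu_stoneExt_eq_infty {A : IntermediateRing X} {r : StoneCech X}
    (hr : r ∉ realPoints A) : ∃ f ∈ (nu A).toSubring, stoneExt f r = OnePoint.infty := by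
  rw [mem_realPoints_iff] at hr
  push Not at hr
  obtain ⟨f, hf, h⟩ := hr
  exact ⟨f, le_nu A hf, h⟩

/-! ### Rings of functions that determine `βX` -/

/-- The ring homomorphism `i : R → C(X)` has a range closed under square roots of nonnegative
functions and under `f ↦ 1 / (1 + f²)`, and it separates the points of `βX`. -/
structure IsSeparatingRootClosed {R : Type*} [CommRing R] (i : R →+* C(X, ℝ)) : Prop where
  exists_sqrt : ∀ f, 0 ≤ i f → ∃ g, 0 ≤ i g ∧ g * g = f
  exists_inv : ∀ f, ∃ g : R, g * (1 + f * f) = 1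
  separates : ∀ r s : StoneCech X, r ≠ s → ∃ f, stoneExt (i f) r ≠ stoneExt (i f) s

namespace IsSeparatingRootClosed

variable {R R' : Type*} [CommRing R] [CommRing R'] {i : R →+* C(X, ℝ)} {j : R' →+* C(X, ℝ)}

/-- Nonnegative members are squares, and squares are a purely ring-theoretic notion. -/
theorem map_nonneg (hi : IsSeparatingRootClosed i) (φ : R ≃+* R') {f : R} (hf : 0 ≤ i f) :
    0 ≤ j (φ f) := by
  obtain ⟨g, -, rfl⟩ := hi.exists_sqrt f hf
  rw [map_mul, map_mul]
  exact fun x => mul_self_nonneg _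

theorem exists_abs (hi : IsSeparatingRootClosed i) (φ : R ≃+* R') (f : R) :
    ∃ g, (∀ x, i g x = |i f x|) ∧ ∀ x, j (φ g) x = |j (φ f) x| := by
  obtain ⟨g, hg, hgf⟩ := hi.exists_sqrt (f * f) (by
    rw [map_mul]
    exact fun x => mul_self_nonneg _)
  refine ⟨g, fun x => ?_, fun x => ?_⟩
  · have h1 : i g x * i g x = i f x * i f x := by
      simpa using DFunLike.congr_fun (congrArg i hgf) x
    exact (abs_of_nonneg (hg x)).symm.trans (abs_eq_abs.2 (mul_self_eq_mul_self_iff.1 h1))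
  · have h1 : j (φ g) x * j (φ g) x = j (φ f) x * j (φ f) x := by
      simpa using DFunLike.congr_fun (congrArg (fun u => j (φ u)) hgf) x
    exact (abs_of_nonneg (hi.map_nonneg (j := j) φ hg x)).symm.trans (abs_eq_abs.2 (mul_self_eq_mul_self_iff.1 h1))

/-- An isomorphism of function rings carries the nonnegative functions vanishing at a point of
`βX` to functions vanishing at a common point of `βX`. -/
theorem exists_common_zero (hi : IsSeparatingRootClosed i) (hj : IsSeparatingRootClosed j)
    (φ : R ≃+* R') (r : StoneCech X) :
    ∃ s : StoneCech X, ∀ u, 0 ≤ i u → Tendsto (i u) (trace r) (𝓝 0) →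
      Tendsto (j (φ u)) (trace s) (𝓝 0) := by
  let I : Type _ := {u : R // 0 ≤ i u ∧ Tendsto (i u) (trace r) (𝓝 0)}
  let Z : I → Set (StoneCech X) := fun u => stoneExt (j (φ u.1)) ⁻¹' {((0 : ℝ) : OnePoint ℝ)}
  have hZ : ∀ u, IsClosed (Z u) := fun u => isClosed_singleton.preimage (continuous_stoneExt _)
  have : Nonempty I := ⟨⟨0, by simp, by
    rw [map_zero]
    exact tendsto_const_nhds⟩⟩
  -- For nonnegative `a` and `b` one has `0 ≤ φ a ≤ φ (a + b)`, so a zero of `φ (a + b)` is a zero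
  -- of `φ a`.
  have hdir : Directed (· ⊇ ·) Z := by
    intro u v
    have hsq : ∀ {a b : R}, 0 ≤ i a → 0 ≤ i b → ∀ s,
        Tendsto (j (φ (a + b))) (trace s) (𝓝 0) → Tendsto (j (φ a)) (trace s) (𝓝 0) := by
      intro a b ha hb s hs
      refine tendsto_of_tendsto_of_tendsto_of_le_of_le tendsto_const_nhds hs
        (fun x => hi.map_nonneg (j := j) φ ha x) fun x => ?_
      have := hi.map_nonneg (j := j) φ hb x
      simpa using this
    refine ⟨⟨u.1 + v.1, ?_, ?_⟩, fun s hs => ?_, fun s hs => ?_⟩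
    · rw [map_add]
      exact add_nonneg u.2.1 v.2.1
    · have := u.2.2.add v.2.2
      rw [add_zero] at this
      rwa [map_add]
    · exact (stoneExt_eq_coe_iff _ _ _).2
        (hsq u.2.1 v.2.1 s ((stoneExt_eq_coe_iff _ _ _).1 hs))
    · refine (stoneExt_eq_coe_iff _ _ _).2
        (hsq v.2.1 u.2.1 s ((stoneExt_eq_coe_iff _ _ _).1 ?_))
      rw [add_comm]
      exact hs
  have hne : ∀ u, (Z u).Nonempty := by
    intro u
    by_contra hemp
    have h0 : ((0 : ℝ) : OnePoint ℝ) ∉ range (stoneExt (j (φ u.1))) := by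
      rintro ⟨s, hs⟩
      exact hemp ⟨s, hs⟩
    have hcl : IsClosed (range (stoneExt (j (φ u.1)))) :=
      (isCompact_range (continuous_stoneExt _)).isClosed
    have hnhds : ((↑) : ℝ → OnePoint ℝ) ⁻¹' (range (stoneExt (j (φ u.1))))ᶜ ∈ 𝓝 (0 : ℝ) :=
      (hcl.isOpen_compl.preimage OnePoint.continuous_coe).mem_nhds h0
    obtain ⟨δ, hδ, hball⟩ := Metric.mem_nhds_iff.1 hnhds
    -- Now `φ u ≥ δ` on `X`, so `n φ u - 1 ≥ 0`. Pulling this back gives `n u ≥ 1`, which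
    -- contradicts `u → 0` at `r`.
    obtain ⟨n, hn⟩ := exists_nat_gt δ⁻¹
    have hpos : 0 ≤ j ((n : R') * φ u.1 - 1) := by
      intro x
      have h1 : δ ≤ j (φ u.1) x := by
        by_contra hlt
        have h2 : 0 ≤ j (φ u.1) x := hi.map_nonneg φ u.2.1 x
        refine hball (a := j (φ u.1) x) ?_ ⟨stoneCechUnit x, stoneExt_unit _ x⟩
        rw [Metric.mem_ball, Real.dist_eq, sub_zero, abs_of_nonneg h2]
        exact not_le.1 hlt
      have h3 : 1 < n * δ := by
        have := mul_lt_mul_of_pos_right hn hδ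
        rwa [inv_mul_cancel₀ hδ.ne'] at this
      have h4 : (n : ℝ) * δ ≤ n * j (φ u.1) x := by gcongr
      simp
      linarith
    have hpos' := hj.map_nonneg (j := i) φ.symm hpos
    have heq : φ.symm ((n : R') * φ u.1 - 1) = (n : R) * u.1 - 1 := by simp
    rw [heq] at hpos'
    have ht : Tendsto (fun x => (n : ℝ) * i u.1 x - 1) (trace r) (𝓝 (n * 0 - 1)) :=
      (u.2.2.const_mul _).sub_const 1
    have := ge_of_tendsto' ht (b := 0) fun x => by simpa using hpos' x
    norm_num at this
  obtain ⟨s, hs⟩ := IsCompact.nonempty_iInter_of_directed_nonempty_isCompact_isClosed Z hdir hne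
    (fun u => (hZ u).isCompact) hZ
  exact ⟨s, fun u h1 h2 => (stoneExt_eq_coe_iff _ _ _).1 (mem_iInter.1 hs ⟨u, h1, h2⟩)⟩

/-- `φ` is not assumed linear over `ℝ`, so the threshold is a rational `b` between `a` and `c`,
cleared to integer coefficients. With `v = num - den · f`, the function `|v| + v` vanishes near `r`,
so its image tends to `0` at `s`; where `φ f ≤ a`, that image is at least `den · (b - a) > 0`. -/
theorem eventually_lt_of_common_zero (hi : IsSeparatingRootClosed i)
    (φ : R ≃+* R') {r s : StoneCech X}
    (hs : ∀ u, 0 ≤ i u → Tendsto (i u) (trace r) (𝓝 0) → Tendsto (j (φ u)) (trace s) (𝓝 0))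
    {f : R} {c a : ℝ} (hf : Tendsto (i f) (trace r) (𝓝 c)) (hac : a < c) :
    ∀ᶠ x in trace s, a < j (φ f) x := by
  obtain ⟨b, hab, hbc⟩ := exists_rat_btwn hac
  have hd : (0 : ℝ) < b.den := by exact_mod_cast b.den_pos
  have hb : (b : ℝ) * b.den = b.num := by exact_mod_cast Rat.mul_den_eq_num b
  let v : R := (b.num : R) - (b.den : R) * f
  obtain ⟨w, hw, hw'⟩ := hi.exists_abs (j := j) φ v
  have hwv : ∀ x, i (w + v) x = |b.num - b.den * i f x| + (b.num - b.den * i f x) := by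
    intro x
    simp [hw, v]
  have hwv' : ∀ x, j (φ (w + v)) x =
      |b.num - b.den * j (φ f) x| + (b.num - b.den * j (φ f) x) := by
    intro x
    rw [map_add, map_add, ContinuousMap.add_apply, hw']
    simp [v]
  have h0 : Tendsto (j (φ (w + v))) (trace s) (𝓝 0) := by
    refine hs _ (fun x => ?_) (tendsto_const_nhds.congr' ?_)
    · change 0 ≤ i (w + v) x
      rw [hwv]
      linarith [neg_abs_le ((b.num : ℝ) - b.den * i f x)]
    · filter_upwards [hf.eventually (lt_mem_nhds hbc)] with x hx
      have : (b.num : ℝ) - b.den * i f x ≤ 0 := by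
        rw [← hb]
        nlinarith
      rw [hwv, abs_of_nonpos this]
      ring
  filter_upwards [h0.eventually (gt_mem_nhds (mul_pos hd (sub_pos.2 hab)))] with x hx
  rw [hwv', ← hb] at hx
  by_contra hle
  have h1 : (b.den : ℝ) * j (φ f) x ≤ b.den * a := by
    have := not_lt.1 hle
    gcongr
  have h2 := abs_nonneg ((b : ℝ) * b.den - b.den * j (φ f) x)
  nlinarith

theorem exists_stoneExt_eq (hi : IsSeparatingRootClosed i) (hj : IsSeparatingRootClosed j)
    (φ : R ≃+* R') (r : StoneCech X) :
    ∃ s : StoneCech X, ∀ f, stoneExt (j (φ f)) s = stoneExt (i f) r := by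
  obtain ⟨s, hs⟩ := hi.exists_common_zero hj φ r
  refine ⟨s, fun f => ?_⟩
  by_cases hinf : stoneExt (i f) r = OnePoint.infty
  -- Infinity is detected by `g = 1 / (1 + f²)`: it tends to `0` at `r`, so `φ g` does at `s`, which
  -- a finite limit of `φ f` would prevent.
  · obtain ⟨g, hg⟩ := hi.exists_inv f
    have hg1 : ∀ x, i g x = (1 + i f x * i f x)⁻¹ := by
      intro x
      have h1 : i g x * (1 + i f x * i f x) = 1 := by
        simpa using DFunLike.congr_fun (congrArg i hg) x
      exact eq_inv_of_mul_eq_one_left h1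
    have hg2 : ∀ x, j (φ g) x * (1 + j (φ f) x * j (φ f) x) = 1 := by
      intro x
      simpa using DFunLike.congr_fun (congrArg (fun u => j (φ u)) hg) x
    have hg0 : Tendsto (i g) (trace r) (𝓝 0) := by
      have h1 : Tendsto (fun x => 1 + i f x * i f x) (trace r) atTop :=
        tendsto_atTop_mono (fun x => by nlinarith [sq_abs (i f x), sq_nonneg (|i f x| - 1)])
          (stoneExt_eq_infty_iff.1 hinf)
      exact (tendsto_inv_atTop_zero.comp h1).congr fun x => (hg1 x).symm
    have hg0' := hs g (fun x => by
      change 0 ≤ i g x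
      rw [hg1]
      have := mul_self_nonneg (i f x)
      positivity) hg0
    rw [hinf]
    by_contra hne
    obtain ⟨a, ha⟩ := (stoneExt_ne_infty_iff _ _).1 hne
    have h1 := hg0'.mul ((ha.mul ha).const_add 1)
    rw [zero_mul] at h1
    exact zero_ne_one (tendsto_nhds_unique h1
      (tendsto_const_nhds.congr fun x => (hg2 x).symm))
  · obtain ⟨c, hc⟩ := (stoneExt_ne_infty_iff _ _).1 hinf
    rw [(stoneExt_eq_coe_iff _ _ _).2 hc, stoneExt_eq_coe_iff]
    refine tendsto_order.2 ⟨fun a ha => hi.eventually_lt_of_common_zero φ hs hc ha,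
      fun a ha => ?_⟩
    have hc' : Tendsto (i (-f)) (trace r) (𝓝 (-c)) := by
      rw [map_neg]
      exact hc.neg
    filter_upwards [hi.eventually_lt_of_common_zero φ hs hc' (neg_lt_neg ha)] with x hx
    simpa using hx

/-- The extensions of members of the second ring embed the compact space `βX` in a power of
`OnePoint ℝ`, and each coordinate of `h` is again a Stone extension. -/
theorem continuous_of_stoneExt_eq (hj : IsSeparatingRootClosed j) (φ : R ≃+* R')
    {h : StoneCech X → StoneCech X} (hh : ∀ r f, stoneExt (j (φ f)) (h r) = stoneExt (i f) r) :
    Continuous h := by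
  let e : StoneCech X → R' → OnePoint ℝ := fun s g => stoneExt (j g) s
  have he : Continuous e := continuous_pi fun g => continuous_stoneExt (j g)
  have hinj : Function.Injective e := by
    intro r s hrs
    by_contra hne
    obtain ⟨g, hg⟩ := hj.separates r s hne
    exact hg (congrFun hrs g)
  rw [(he.isClosedEmbedding hinj).isInducing.continuous_iff]
  refine continuous_pi fun g => ?_
  have : (fun r => (e ∘ h) r g) = stoneExt (i (φ.symm g)) := by
    funext r
    rw [← hh, φ.apply_symm_apply]
    rfl
  rw [this]
  exact continuous_stoneExt _

theorem exists_homeomorph (hi : IsSeparatingRootClosed i) (hj : IsSeparatingRootClosed j)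
    (φ : R ≃+* R') : ∃ h : StoneCech X ≃ₜ StoneCech X, ∀ f, Transports h (i f) (j (φ f)) := by
  choose h hh using hi.exists_stoneExt_eq hj φ
  choose k hk using hj.exists_stoneExt_eq hi φ.symm
  refine ⟨{ toFun := h, invFun := k, left_inv := fun r => ?_, right_inv := fun s => ?_,
            continuous_toFun := hj.continuous_of_stoneExt_eq φ hh,
            continuous_invFun := hi.continuous_of_stoneExt_eq φ.symm hk },
    fun f r => hh r f⟩
  · by_contra hne
    obtain ⟨f, hf⟩ := hi.separates _ _ hne
    apply hf
    rw [← hh r, ← hk, φ.symm_apply_apply]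
  · by_contra hne
    obtain ⟨g, hg⟩ := hj.separates _ _ hne
    apply hg
    rw [← hk s, ← hh, φ.apply_symm_apply]

end IsSeparatingRootClosed

/-! ### The residue field and its copies -/

variable {A : IntermediateRing X} {p : StoneCech X}

theorem theta_eq_iff {f g : (nu A).toSubring} :
    theta A p f = theta A p g ↔ f - g ∈ nuIdeal A p :=
  Ideal.Quotient.mk_eq_mk_iff_sub_mem f g

theorem theta_eq_zero_iff {f : (nu A).toSubring} : theta A p f = 0 ↔ f ∈ nuIdeal A p :=
  Ideal.Quotient.eq_zero_iff_mem

theorem theta_congr {f g : (nu A).toSubring}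
    (h : (f : C(X, ℝ)) =ᶠ[trace p] (g : C(X, ℝ))) : theta A p f = theta A p g := by
  refine theta_eq_iff.2 (mem_maxIdeal_of_eventually_eq_zero ?_)
  filter_upwards [h] with x hx
  simp [hx]

theorem isField_residueField (A : IntermediateRing X) (p : StoneCech X) :
    IsField (ResidueField A p) where
  exists_pair_ne := by
    refine ⟨theta A p 0, theta A p 1, fun h => ?_⟩
    have h1 := tendsto_of_mem_maxIdeal (theta_eq_iff.1 h.symm)
    rw [sub_zero] at h1
    exact one_ne_zero (tendsto_nhds_unique (tendsto_const_nhds (x := (1 : ℝ))) h1)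
  mul_comm := mul_comm
  mul_inv_cancel := by
    intro a ha
    obtain ⟨f, rfl⟩ := Ideal.Quotient.mk_surjective a
    obtain ⟨g, hg⟩ := exists_mul_sub_one_mem_maxIdeal fun h => ha (theta_eq_zero_iff.2 h)
    exact ⟨theta A p g, by rw [← map_mul, ← map_one (theta A p)]; exact theta_eq_iff.2 hg⟩

/-- `A^ν(X)` is closed under `f ↦ √f⁺`. -/
theorem exists_nu_sqrt (f : (nu A).toSubring) :
    ∃ g : (nu A).toSubring, ∀ x, (g : C(X, ℝ)) x = √((f : C(X, ℝ)) x) := by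
  refine ⟨⟨⟨fun x => √((f : C(X, ℝ)) x), by fun_prop⟩, fun r hr => ?_⟩, fun x => rfl⟩
  obtain ⟨a, ha⟩ := (stoneExt_ne_infty_iff _ _).1 (f.2 r hr)
  exact (stoneExt_ne_infty_iff _ _).2 ⟨√a, (Real.continuous_sqrt.tendsto a).comp ha⟩

/-- Write `f = g² - k²` with `g = √f⁺`, `k = √f⁻` and `g k = 0`; in a field one of the two classes
vanishes. -/
theorem exists_mul_self_residueField (a : ResidueField A p) : ∃ b, b * b = a ∨ b * b = -a := by
  let _ := (isField_residueField A p).toField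
  obtain ⟨f, rfl⟩ := Ideal.Quotient.mk_surjective a
  obtain ⟨g, hg⟩ := exists_nu_sqrt f
  obtain ⟨k, hk⟩ := exists_nu_sqrt (-f)
  have h1 : g * g - k * k = f := by
    ext x
    have h2 : (g * g - k * k : C(X, ℝ)) x = (f : C(X, ℝ)) x := by
      simp only [ContinuousMap.sub_apply, ContinuousMap.mul_apply, hg, hk]
      rcases le_total 0 ((f : C(X, ℝ)) x) with h0 | h0
      · simp [Real.mul_self_sqrt h0, Real.sqrt_eq_zero_of_nonpos, h0]
      · have : 0 ≤ -(f : C(X, ℝ)) x := neg_nonneg.2 h0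
        simp [Real.mul_self_sqrt this, Real.sqrt_eq_zero_of_nonpos, h0]
    exact h2
  have h3 : g * k = 0 := by
    ext x
    have h2 : (g * k : C(X, ℝ)) x = 0 := by
      simp only [ContinuousMap.mul_apply, hg, hk]
      rcases le_total 0 ((f : C(X, ℝ)) x) with h0 | h0
      · simp [Real.sqrt_eq_zero_of_nonpos, h0]
      · simp [Real.sqrt_eq_zero_of_nonpos, h0]
    exact h2
  have h4 : theta A p g * theta A p k = 0 := by rw [← map_mul, h3, map_zero]
  have h5 : theta A p g * theta A p g - theta A p k * theta A p k = theta A p f := by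
    rw [← map_mul, ← map_mul, ← map_sub, h1]
  rcases mul_eq_zero.1 h4 with h0 | h0
  · exact ⟨theta A p k, Or.inr (by rw [← h5, h0]; ring)⟩
  · exact ⟨theta A p g, Or.inl (by rw [← h5, h0]; ring)⟩

theorem exists_mul_self_mem {F : Subring (ResidueField A p)} (hF : IsProperCopy F)
    {a : ResidueField A p} (ha : a ∈ F) : ∃ b ∈ F, b * b = a ∨ b * b = -a := by
  obtain ⟨-, ⟨e⟩⟩ := hF
  obtain ⟨b, hb⟩ := exists_mul_self_residueField (e.symm ⟨a, ha⟩)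
  refine ⟨e b, (e b).2, hb.imp (fun h => ?_) fun h => ?_⟩
  · have := congrArg (fun c => ((e c : F) : ResidueField A p)) h
    simpa using this
  · have := congrArg (fun c => ((e c : F) : ResidueField A p)) h
    simpa using this

/-- The ideal is convex: `f + g²` lies in it and `0 ≤ f ≤ f + g²`. -/
theorem theta_eq_zero_of_nonneg_of_add_mul_self {f g : (nu A).toSubring}
    (hf : ∀ x, 0 ≤ (f : C(X, ℝ)) x) (h : theta A p g * theta A p g = -theta A p f) :
    theta A p f = 0 := by
  have h1 : f + g * g ∈ nuIdeal A p := by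
    rw [← theta_eq_zero_iff, map_add, map_mul, h, add_neg_cancel]
  refine theta_eq_zero_iff.2 (mem_maxIdeal_iff.2 fun k hk => ?_)
  refine squeeze_zero_norm (fun x => ?_)
    (tendsto_zero_iff_norm_tendsto_zero.1 (mem_maxIdeal_iff.1 h1 k hk))
  have h2 := hf x
  have h3 := mul_self_nonneg ((g : C(X, ℝ)) x)
  simp only [ContinuousMap.coe_mul, Pi.mul_apply, Subring.coe_add, Subring.coe_mul,
    ContinuousMap.coe_add, Pi.add_apply, norm_mul, Real.norm_eq_abs]
  gcongr
  linarith

/-- `F` contains a root `b` of `θ f` or of `-θ f`. In the first case `θ g = ±b`; in the second,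
convexity forces `θ f = 0`, so `θ g = 0`. -/
theorem theta_sqrt_mem {F : Subring (ResidueField A p)} (hF : IsProperCopy F)
    {f g : (nu A).toSubring} (hf : ∀ x, 0 ≤ (f : C(X, ℝ)) x) (hfF : theta A p f ∈ F)
    (hg : g * g = f) : theta A p g ∈ F := by
  let _ := (isField_residueField A p).toField
  have hg' : theta A p g * theta A p g = theta A p f := by rw [← map_mul, hg]
  obtain ⟨b, hb, h | h⟩ := exists_mul_self_mem hF hfF
  · rcases mul_self_eq_mul_self_iff.1 (hg'.trans h.symm) with h1 | h1
    · rwa [h1]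
    · rw [h1]
      exact neg_mem hb
  · obtain ⟨k, rfl⟩ := Ideal.Quotient.mk_surjective b
    have h0 := theta_eq_zero_of_nonneg_of_add_mul_self hf h
    rw [h0, mul_self_eq_zero] at hg'
    rw [hg']
    exact zero_mem F

/-! ### The rings `B_p^F(X)` -/

variable {F : Subring (ResidueField A p)}

theorem mem_ringB_iff {f : (nu A).toSubring} : f ∈ ringB A p F ↔ theta A p f ∈ F := Iff.rfl

theorem mem_ringB_of_mem_nuIdeal {f : (nu A).toSubring} (hf : f ∈ nuIdeal A p) :
    f ∈ ringB A p F := by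
  rw [mem_ringB_iff, theta_eq_zero_iff.2 hf]
  exact zero_mem F

variable (F) in
/-- The inclusion of `B_p^F(X)` in `C(X)`. -/
def ringBIncl : ringB A p F →+* C(X, ℝ) := (nu A).toSubring.subtype.comp (ringB A p F).subtype

theorem ringBIncl_apply (f : ringB A p F) : ringBIncl F f = ((f : (nu A).toSubring) : C(X, ℝ)) :=
  rfl

/-- `A^ν(X)` contains functions that are `1` near `r` and vanish near the points of `C`. -/
theorem exists_nu_bump {r : StoneCech X} {C : Set (StoneCech X)} (hC : IsClosed C) (hr : r ∉ C) :
    ∃ k : (nu A).toSubring, (∀ᶠ x in trace r, (k : C(X, ℝ)) x = 1) ∧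
      ∀ c ∈ C, ∀ᶠ x in trace c, (k : C(X, ℝ)) x = 0 := by
  obtain ⟨k, hk, h1, h0⟩ := exists_bump hC hr
  exact ⟨⟨k, (nu A).bounded_mem k ⟨1, hk⟩⟩, h1, h0⟩

theorem exists_ringB_stoneExt_ne {r s : StoneCech X} (hrs : r ≠ s) (hrp : r ≠ p) :
    ∃ f : ringB A p F, stoneExt (ringBIncl F f) r ≠ stoneExt (ringBIncl F f) s := by
  obtain ⟨k, h1, h0⟩ := exists_nu_bump (A := A) (r := r) (C := {s, p})
    (Set.toFinite _).isClosed (by simp [hrs, hrp])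
  refine ⟨⟨k, mem_ringB_of_mem_nuIdeal
    (mem_maxIdeal_of_eventually_eq_zero (h0 p (by simp)))⟩, fun h => ?_⟩
  have hr : stoneExt (k : C(X, ℝ)) r = ((1 : ℝ) : OnePoint ℝ) := (stoneExt_eq_coe_iff _ _ _).2
    (tendsto_const_nhds.congr' (h1.mono fun _ hx => hx.symm))
  have hs : stoneExt (k : C(X, ℝ)) s = ((0 : ℝ) : OnePoint ℝ) := (stoneExt_eq_coe_iff _ _ _).2
    (tendsto_const_nhds.congr' ((h0 s (by simp)).mono fun _ hx => hx.symm))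
  exact one_ne_zero (OnePoint.coe_injective (hr.symm.trans (h.trans hs)))

theorem isSeparatingRootClosed_ringBIncl (hF : IsProperCopy F) :
    IsSeparatingRootClosed (ringBIncl F) where
  exists_sqrt f hf := by
    obtain ⟨g, hg⟩ := exists_nu_sqrt (f : (nu A).toSubring)
    have hgf : g * g = f := by
      ext x
      have h2 : (g * g : C(X, ℝ)) x = ((f : (nu A).toSubring) : C(X, ℝ)) x := by
        rw [ContinuousMap.mul_apply, hg]
        exact Real.mul_self_sqrt (hf x)
      exact h2
    refine ⟨⟨g, theta_sqrt_mem hF hf f.2 hgf⟩, fun x => ?_, Subtype.ext hgf⟩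
    change 0 ≤ (g : C(X, ℝ)) x
    rw [hg]
    exact Real.sqrt_nonneg _
  exists_inv f := by
    have hpos : ∀ x, 0 < 1 + ringBIncl F f x * ringBIncl F f x := fun x => by
      have := mul_self_nonneg (ringBIncl F f x)
      positivity
    let k : C(X, ℝ) := ⟨fun x => (1 + ringBIncl F f x * ringBIncl F f x)⁻¹,
      Continuous.inv₀ (by fun_prop) fun x => (hpos x).ne'⟩
    let g : (nu A).toSubring := ⟨k, (nu A).bounded_mem k ⟨1, fun x => by
      change |(1 + ringBIncl F f x * ringBIncl F f x)⁻¹| ≤ 1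
      rw [abs_of_pos (inv_pos.2 (hpos x))]
      exact inv_le_one_of_one_le₀ (by linarith [mul_self_nonneg (ringBIncl F f x)])⟩⟩
    have hg : g * (1 + f * f : ringB A p F) = 1 := by
      ext x
      exact inv_mul_cancel₀ (hpos x).ne'
    have hgθ : theta A p g * theta A p (1 + f * f : ringB A p F) = 1 := by
      rw [← map_mul, hg, map_one]
    -- `F` is only a subring by type; its inverses are carried over from `K_p` by `e` and agree with
    -- those of `K_p` by uniqueness.
    have hmem : theta A p g ∈ F := by
      let _ := (isField_residueField A p).toField
      obtain ⟨e⟩ := hF.2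
      have hne : e.symm ⟨_, (1 + f * f : ringB A p F).2⟩ ≠ 0 := by
        rw [Ne, EmbeddingLike.map_eq_zero_iff]
        intro h0
        have h1 : theta A p (1 + f * f : ringB A p F) = 0 := congrArg Subtype.val h0
        rw [h1, mul_zero] at hgθ
        exact zero_ne_one hgθ
      have h2 := congrArg e (inv_mul_cancel₀ hne)
      rw [map_mul, map_one, e.apply_symm_apply] at h2
      have h3 := congrArg Subtype.val h2
      rw [eq_inv_of_mul_eq_one_left hgθ, ← eq_inv_of_mul_eq_one_left h3]
      exact (e _).2
    exact ⟨⟨g, hmem⟩, Subtype.ext hg⟩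
  separates r s hrs := by
    by_cases hr : r = p
    · have hs : s ≠ p := fun h => hrs (hr.trans h.symm)
      obtain ⟨f, hf⟩ := exists_ringB_stoneExt_ne (F := F) hrs.symm hs
      exact ⟨f, hf.symm⟩
    · exact exists_ringB_stoneExt_ne hrs hr

/-- A copy of the nonarchimedean field `A^ν(X) / M_{A^ν}^p` is nonarchimedean. -/
theorem exists_ringB_stoneExt_eq_infty_self (hp : p ∉ realPoints A) (hF : IsProperCopy F) :
    ∃ f : ringB A p F, stoneExt (ringBIncl F f) p = OnePoint.infty := by
  obtain ⟨f, hf, hinf⟩ := exists_nu_stoneExt_eq_infty hp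
  rw [stoneExt_eq_infty_iff] at hinf
  let f' : (nu A).toSubring := ⟨f, hf⟩
  -- That the class of `f²` exceeds every integer is expressed by squares, so the isomorphism onto
  -- `F` preserves it.
  have hsq : ∀ n : ℕ, ∃ b : ResidueField A p, b * b = theta A p (f' * f') - n := by
    intro n
    obtain ⟨g, hg⟩ := exists_nu_sqrt (f' * f' - (n : (nu A).toSubring))
    refine ⟨theta A p g, ?_⟩
    rw [← map_mul, ← map_natCast (theta A p), ← map_sub]
    refine theta_congr ?_
    filter_upwards [tendsto_atTop.1 hinf (n + 1)] with x hx
    have h0 : 0 ≤ ((f' * f' - (n : (nu A).toSubring) : (nu A).toSubring) : C(X, ℝ)) x := by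
      change 0 ≤ f x * f x - ((n : C(X, ℝ)) x)
      rw [ContinuousMap.natCast_apply]
      have hn : (0 : ℝ) ≤ n := n.cast_nonneg
      nlinarith [abs_mul_abs_self (f x)]
    change (g : C(X, ℝ)) x * (g : C(X, ℝ)) x = _
    rw [hg, Real.mul_self_sqrt h0]
  obtain ⟨e⟩ := hF.2
  obtain ⟨u, hu⟩ := Ideal.Quotient.mk_surjective
    ((e (theta A p (f' * f')) : F) : ResidueField A p)
  have huF : theta A p u ∈ F := by
    rw [theta, hu]
    exact (e _).2
  refine ⟨⟨u, huF⟩, stoneExt_eq_infty_iff.2 (tendsto_atTop.2 fun C => ?_)⟩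
  -- The extra `1` absorbs the error in `v² ≡ u - n`, an identity valid only modulo the ideal: near
  -- `p`, `v² - (u - n) < 1`.
  obtain ⟨n, hn⟩ := exists_nat_gt (C + 1)
  obtain ⟨b, hb⟩ := hsq n
  obtain ⟨v, hv⟩ := Ideal.Quotient.mk_surjective ((e b : F) : ResidueField A p)
  have h1 : theta A p (v * v) = theta A p (u - (n : (nu A).toSubring)) := by
    have h2 := congrArg (fun c => ((e c : F) : ResidueField A p)) hb
    simp only [map_mul, map_sub, map_natCast, Subring.coe_mul, AddSubgroupClass.coe_sub] at h2
    rw [map_mul, map_sub, map_natCast, theta, hv, hu, h2]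
    simp
  have h3 := tendsto_of_mem_maxIdeal (theta_eq_iff.1 h1)
  filter_upwards [h3.eventually (gt_mem_nhds one_pos)] with x hx
  have hx' : (v : C(X, ℝ)) x * (v : C(X, ℝ)) x - ((u : C(X, ℝ)) x - (n : C(X, ℝ)) x) < 1 := hx
  rw [ContinuousMap.natCast_apply] at hx'
  change C ≤ |(u : C(X, ℝ)) x|
  linarith [mul_self_nonneg ((v : C(X, ℝ)) x), le_abs_self ((u : C(X, ℝ)) x)]

theorem exists_ringB_stoneExt_eq_infty (hp : p ∉ realPoints A) (hF : IsProperCopy F)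
    {r : StoneCech X} (hr : r ∉ realPoints A) :
    ∃ f : ringB A p F, stoneExt (ringBIncl F f) r = OnePoint.infty := by
  by_cases hrp : r = p
  · rw [hrp]
    exact exists_ringB_stoneExt_eq_infty_self hp hF
  obtain ⟨f, hf, hinf⟩ := exists_nu_stoneExt_eq_infty hr
  -- Cutting `f` off near `p` puts it in the ideal, hence in the ring, without changing it near `r`.
  obtain ⟨k, h1, h0⟩ := exists_nu_bump (A := A) (r := r) (C := {p}) isClosed_singleton hrp
  refine ⟨⟨⟨f, hf⟩ * k, mem_ringB_of_mem_nuIdeal (mem_maxIdeal_of_eventually_eq_zero ?_)⟩, ?_⟩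
  · filter_upwards [h0 p rfl] with x hx
    simp [hx]
  · rw [← hinf]
    refine stoneExt_congr ?_
    filter_upwards [h1] with x hx
    simp [ringBIncl_apply, hx]

/-! ### Isomorphisms of the rings `B_p^F(X)` -/

variable {A : IntermediateRing X} {p q : StoneCech X} {F : Subring (ResidueField A p)}
  {F' : Subring (ResidueField A q)} {h : StoneCech X ≃ₜ StoneCech X}

theorem mem_realPoints_of_transports (hp : p ∉ realPoints A) (hF : IsProperCopy F)
    {φ : ringB A p F → ringB A q F'}
    (hφ : ∀ f, Transports h (ringBIncl F f) (ringBIncl F' (φ f))) {r : StoneCech X}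
    (hr : h r ∈ realPoints A) : r ∈ realPoints A := by
  by_contra hr'
  obtain ⟨f, hf⟩ := exists_ringB_stoneExt_eq_infty hp hF hr'
  exact (φ f : (nu A).toSubring).2 _ hr ((hφ f r).trans hf)

/-- Points of `X` are real, so `f*` is finite on `h⁻¹(X)` and the transported function exists. -/
theorem exists_nu_transports (hY : ∀ r, h r ∈ realPoints A ↔ r ∈ realPoints A)
    (f : (nu A).toSubring) :
    ∃ g : (nu A).toSubring, Transports h (f : C(X, ℝ)) g := by
  have hfin : ∀ r, h r ∈ realPoints A → stoneExt (f : C(X, ℝ)) r ≠ OnePoint.infty := fun r hr =>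
    f.2 r ((hY r).1 hr)
  obtain ⟨g, hg⟩ := exists_transports (f := (f : C(X, ℝ))) (h := h) fun x => hfin _ (by
    rw [h.apply_symm_apply]
    exact unit_mem_realPoints A x)
  refine ⟨⟨g, fun s hs => ?_⟩, hg⟩
  rw [← h.apply_symm_apply s, hg]
  exact hfin _ (by rwa [h.apply_symm_apply])

/-- An isomorphism `B_p^F(X) ≃ B_q^{F'}(X)` comes from a homeomorphism of `βX` that carries `p`
to `q` and preserves the real points. -/
theorem exists_homeomorph_of_ringEquiv (hp : p ∉ realPoints A) (hq : q ∉ realPoints A)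
    (hF : IsProperCopy F) (hF' : IsProperCopy F') (φ : ringB A p F ≃+* ringB A q F') :
    ∃ h : StoneCech X ≃ₜ StoneCech X, h p = q ∧
      (∀ f, Transports h (ringBIncl F f) (ringBIncl F' (φ f))) ∧
      ∀ r, h r ∈ realPoints A ↔ r ∈ realPoints A := by
  obtain ⟨h, hh⟩ := (isSeparatingRootClosed_ringBIncl hF).exists_homeomorph
    (isSeparatingRootClosed_ringBIncl hF') φ
  have hh' : ∀ g, Transports h.symm (ringBIncl F' g) (ringBIncl F (φ.symm g)) := fun g => by
    have := (hh (φ.symm g)).symm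
    rwa [φ.apply_symm_apply] at this
  have hY : ∀ r, h r ∈ realPoints A ↔ r ∈ realPoints A := fun r =>
    ⟨mem_realPoints_of_transports hp hF hh, fun hr =>
      mem_realPoints_of_transports hq hF' hh' (by rwa [h.symm_apply_apply])⟩
  refine ⟨h, ?_, hh, hY⟩
  by_contra hpq
  -- Properness enters here: if `h p ≠ q`, a class outside `F` will be represented by a member of
  -- `B_p^F`. The transport `g` of a representative `f` is cut off near `q` and left unchanged near
  -- `h p`, then pulled back by `φ`.
  obtain ⟨a, haF⟩ : ∃ a, a ∉ F := by
    by_contra hall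
    push Not at hall
    exact hF.1 ((Subring.eq_top_iff' F).2 hall)
  obtain ⟨f, rfl⟩ := Ideal.Quotient.mk_surjective a
  obtain ⟨g, hg⟩ := exists_nu_transports hY f
  obtain ⟨k, hk1, hk0⟩ := exists_nu_bump (A := A) (r := h p) (C := {q}) isClosed_singleton hpq
  have hgk : g * k ∈ ringB A q F' := by
    refine mem_ringB_of_mem_nuIdeal (mem_maxIdeal_of_eventually_eq_zero ?_)
    filter_upwards [hk0 q rfl] with x hx
    simp [hx]
  -- the function carried to `g * k` agrees with `f` up to an element of the ideal at `p`
  obtain ⟨l, hl⟩ := exists_nu_transports (h := h.symm)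
    (fun r => by rw [← hY, h.apply_symm_apply]) (1 - k)
  have hl' : Transports h (l : C(X, ℝ)) ((1 - k : (nu A).toSubring) : C(X, ℝ)) := hl.symm
  have hw := hh (φ.symm ⟨g * k, hgk⟩)
  rw [φ.apply_symm_apply] at hw
  have hdiff : (f : C(X, ℝ)) - ringBIncl F (φ.symm ⟨g * k, hgk⟩) = f * l := by
    refine (hg.sub hw).left_unique ?_
    have : (g : C(X, ℝ)) - ringBIncl F' ⟨g * k, hgk⟩ =
        g * ((1 - k : (nu A).toSubring) : C(X, ℝ)) := by
      change (g : C(X, ℝ)) - g * k = g * (1 - k)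
      ring
    rw [this]
    exact hg.mul hl'
  -- Each multiple `f l m` with `m` in `A^ν` transports to `g (1 - k) m'`, which vanishes near `h
  -- p`.
  have hmem : f * l ∈ nuIdeal A p := by
    refine mem_maxIdeal_iff.2 fun m hm => ?_
    obtain ⟨m', hm'⟩ := exists_nu_transports hY ⟨m, hm⟩
    refine (((hg.mul hl').mul hm').tendsto_iff rfl).2 (tendsto_const_nhds.congr' ?_)
    filter_upwards [hk1] with x hx
    simp [hx]
  have hθ : theta A p f = theta A p (φ.symm ⟨g * k, hgk⟩ : ringB A p F) := by
    refine theta_eq_iff.2 ?_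
    have : f - (φ.symm ⟨g * k, hgk⟩ : ringB A p F) = f * l := Subtype.ext hdiff
    rwa [this]
  exact haF (hθ ▸ (φ.symm ⟨g * k, hgk⟩).2)

/-! ### Correspondence of ideals and residue classes under transport -/

theorem Transports.mem_nuIdeal (hpq : h p = q)
    (hN : ∀ g : (nu A).toSubring, ∃ f : (nu A).toSubring, Transports h (f : C(X, ℝ)) g)
    {f g : (nu A).toSubring} (hT : Transports h (f : C(X, ℝ)) g) (hf : f ∈ nuIdeal A p) :
    g ∈ nuIdeal A q := by
  refine mem_maxIdeal_iff.2 fun k hk => ?_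
  obtain ⟨l, hl⟩ := hN ⟨k, hk⟩
  exact ((hT.mul hl).tendsto_iff hpq).1 (mem_maxIdeal_iff.1 hf l l.2)

theorem Transports.mem_nuIdeal_iff (hpq : h p = q)
    (hN : ∀ f : (nu A).toSubring, ∃ g : (nu A).toSubring, Transports h (f : C(X, ℝ)) g)
    (hN' : ∀ g : (nu A).toSubring, ∃ f : (nu A).toSubring, Transports h (f : C(X, ℝ)) g)
    {f g : (nu A).toSubring} (hT : Transports h (f : C(X, ℝ)) g) :
    f ∈ nuIdeal A p ↔ g ∈ nuIdeal A q :=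
  ⟨hT.mem_nuIdeal hpq hN', hT.symm.mem_nuIdeal (by rw [← hpq, h.symm_apply_apply])
    fun f => (hN f).imp fun _ hg => hg.symm⟩

variable (F) in
/-- The surjection `B_p^F(X) → F`. -/
def ringBTheta : ringB A p F →+* F :=
  ((theta A p).comp (ringB A p F).subtype).codRestrict F fun f => f.2

theorem ringBTheta_surjective : Function.Surjective (ringBTheta F) := by
  rintro ⟨a, ha⟩
  obtain ⟨f, rfl⟩ := Ideal.Quotient.mk_surjective a
  exact ⟨⟨f, ha⟩, rfl⟩

theorem mem_ker_ringBTheta {f : ringB A p F} :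
    f ∈ RingHom.ker (ringBTheta F) ↔ (f : (nu A).toSubring) ∈ nuIdeal A p := by
  rw [RingHom.mem_ker, ← theta_eq_zero_iff]
  exact Subtype.ext_iff

/-- An isomorphism `B_p^F(X) ≃ B_q^{F'}(X)` that matches the ideals at `p` and `q` induces
an isomorphism `F ≃ F'`. -/
theorem exists_ringEquiv_residue (φ : ringB A p F ≃+* ringB A q F')
    (hφ : ∀ f : ringB A p F, (f : (nu A).toSubring) ∈ nuIdeal A p ↔ (φ f : (nu A).toSubring) ∈ nuIdeal A q) :
    ∃ ρ : F ≃+* F', ∀ f, ρ (ringBTheta F f) = ringBTheta F' (φ f) := by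
  have hker : RingHom.ker (ringBTheta F') = (RingHom.ker (ringBTheta F)).map (φ : _ →+* _) := by
    ext g
    rw [Ideal.map_comap_of_equiv, Ideal.mem_comap, mem_ker_ringBTheta, mem_ker_ringBTheta]
    change _ ↔ ((φ.symm g : ringB A p F) : (nu A).toSubring) ∈ _
    rw [hφ, φ.apply_symm_apply]
  let e := RingHom.quotientKerEquivOfSurjective (ringBTheta_surjective (F := F))
  let e' := RingHom.quotientKerEquivOfSurjective (ringBTheta_surjective (F := F'))
  refine ⟨(e.symm.trans (Ideal.quotientEquiv _ _ φ hker)).trans e', fun f => ?_⟩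
  have : e.symm (ringBTheta F f) = Ideal.Quotient.mk _ f := by
    rw [e.symm_apply_eq]
    rfl
  simp only [RingEquiv.trans_apply, this]
  rfl

/-- A homeomorphism that induces `ρ : F ≃ F'` transports `B_p^F(X)` onto `B_q^{F'}(X)`. -/
theorem Induces.mem_ringB_iff {ρ : F ≃+* F'} (hρ : Induces A h ρ) (hpq : h p = q)
    {f g : (nu A).toSubring} (hT : Transports h (f : C(X, ℝ)) g) :
    f ∈ ringB A p F ↔ g ∈ ringB A q F' := by
  obtain ⟨hN, hN', hind⟩ := hρ
  constructor
  · intro hf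
    rw [IntermediateRings.mem_ringB_iff, ← hind f g hT hf]
    exact (ρ _).2
  · intro hg
    -- The class of `g` has a preimage under `ρ`, represented by some `f'`. Its transport is
    -- congruent to `g` modulo the ideal at `q`, so `f'` is congruent to `f` modulo the ideal at
    -- `p`.
    obtain ⟨a, ha⟩ := ρ.surjective ⟨theta A q g, hg⟩
    obtain ⟨a, haF⟩ := a
    obtain ⟨f', rfl⟩ := Ideal.Quotient.mk_surjective a
    obtain ⟨g', hT'⟩ := hN f'
    have h1 : theta A q g' = theta A q g := by
      rw [← hind f' g' hT' haF]
      exact congrArg Subtype.val ha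
    have h2 : f' - f ∈ nuIdeal A p :=
      (Transports.mem_nuIdeal_iff hpq hN hN' (f := f' - f) (g := g' - g) (hT'.sub hT)).2
        (theta_eq_iff.1 h1)
    rw [IntermediateRings.mem_ringB_iff, ← theta_eq_iff.2 h2]
    exact haF

/-- Uniqueness of transports in both directions makes the chosen maps mutually inverse and
compatible with the ring operations. -/
theorem Induces.nonempty_ringEquiv {ρ : F ≃+* F'} (hρ : Induces A h ρ) (hpq : h p = q) :
    Nonempty (ringB A p F ≃+* ringB A q F') := by
  choose T hT using hρ.1
  choose S hS using hρ.2.1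
  refine ⟨{ toFun := fun f => ⟨T f, (hρ.mem_ringB_iff hpq (hT f)).1 f.2⟩
            invFun := fun g => ⟨S g, (hρ.mem_ringB_iff hpq (hS g)).2 g.2⟩
            left_inv := fun f => ?_
            right_inv := fun g => ?_
            map_mul' := fun f g => ?_
            map_add' := fun f g => ?_ }⟩
  · exact Subtype.ext (Subtype.ext ((hS (T f)).left_unique (hT f)))
  · exact Subtype.ext (Subtype.ext ((hT (S g)).right_unique (hS g)))
  · exact Subtype.ext (Subtype.ext ((hT (f * g)).right_unique ((hT f).mul (hT g))))
  · exact Subtype.ext (Subtype.ext ((hT (f + g)).right_unique ((hT f).add (hT g))))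

theorem exists_homeomorph_induces (hp : p ∉ realPoints A) (hq : q ∉ realPoints A)
    (hF : IsProperCopy F) (hF' : IsProperCopy F') (φ : ringB A p F ≃+* ringB A q F') :
    (∀ f : ringB A p F, (f : (nu A).toSubring) ∈ nuIdeal A p ↔
        (φ f : (nu A).toSubring) ∈ nuIdeal A q) ∧
      ∃ h : StoneCech X ≃ₜ StoneCech X, h p = q ∧ ∃ ρ : F ≃+* F', Induces A h ρ := by
  obtain ⟨h, hpq, hh, hY⟩ := exists_homeomorph_of_ringEquiv hp hq hF hF' φ
  have hN := fun f : (nu A).toSubring => exists_nu_transports hY f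
  have hN' : ∀ g : (nu A).toSubring, ∃ f : (nu A).toSubring, Transports h (f : C(X, ℝ)) g :=
    fun g => (exists_nu_transports (h := h.symm)
      (fun r => by rw [← hY, h.apply_symm_apply]) g).imp fun _ hg => hg.symm
  have hφ : ∀ f : ringB A p F, (f : (nu A).toSubring) ∈ nuIdeal A p ↔
      (φ f : (nu A).toSubring) ∈ nuIdeal A q := fun f =>
    Transports.mem_nuIdeal_iff hpq hN hN' (hh f)
  obtain ⟨ρ, hρ⟩ := exists_ringEquiv_residue φ hφ
  refine ⟨hφ, h, hpq, ρ, hN, hN', fun f g hT hf => ?_⟩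
  have h1 : ((φ ⟨f, hf⟩ : ringB A q F') : (nu A).toSubring) = g :=
    Subtype.ext ((hh ⟨f, hf⟩).right_unique hT)
  rw [← h1]
  exact congrArg Subtype.val (hρ ⟨f, hf⟩)

end IntermediateRings

end

/-! ### The main theorem -/

open IntermediateRings in
theorem mainTheorem3 {X : Type*} [TopologicalSpace X] [T35Space X]
    (A : IntermediateRing X) (p q : StoneCech X)
    (hp : p ∉ realPoints A) (hq : q ∉ realPoints A)
    (F : Subring (ResidueField A p)) (hF : IsProperCopy F)
    (F' : Subring (ResidueField A q)) (hF' : IsProperCopy F') :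
    (Nonempty (ringB A p F ≃+* ringB A q F') ↔
      ∃ h : StoneCech X ≃ₜ StoneCech X, h p = q ∧ ∃ ρ : F ≃+* F', Induces A h ρ) ∧
    ∀ φ : ringB A p F ≃+* ringB A q F',
      φ '' {f : ringB A p F | (f : (nu A).toSubring) ∈ nuIdeal A p} =
        {g : ringB A q F' | (g : (nu A).toSubring) ∈ nuIdeal A q} := by
  refine ⟨⟨fun ⟨φ⟩ => (exists_homeomorph_induces hp hq hF hF' φ).2,
    fun ⟨h, hpq, ρ, hρ⟩ => hρ.nonempty_ringEquiv hpq⟩, fun φ => ?_⟩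
  have hφ := (exists_homeomorph_induces hp hq hF hF' φ).1
  ext g
  constructor
  · rintro ⟨f, hf, rfl⟩
    exact (hφ f).1 hf
  · intro hg
    refine ⟨φ.symm g, (hφ _).2 ?_, φ.apply_symm_apply g⟩
    rwa [φ.apply_symm_apply]
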